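/- Let $\mathbb T$ be the unit circle with normalized Lebesgue measure. For $p\in\{2,\infty\}$, $H^p(\mathbb M_{m,n})$ denotes the $m\times n$ matrix functions on $\mathbb T$ whose entries are in $L^p(\mathbb T)$ and have vanishing Fourier coefficients of negative index, and $H^2(\mathbb C^n)\subset L^2(\mathbb C^n)$ is defined likewise. For $\Phi\in L^\infty(\mathbb M_{m,n})$ the Toeplitz operator $T_\Phi:H^2(\mathbb C^n)\to H^2(\mathbb C^m)$ is $T_\Phi f=\mathbb P_+(\Phi f)$, where $\mathbb P_+$ is the orthogonal projection of $L^2(\mathbb C^m)$ onto $H^2(\mathbb C^m)$. A function $\Phi\in H^\infty(\mathbb M_{m,n})$ is inner if $\Phi(\zeta)^*\Phi(\zeta)=I_n$ for almost all $\zeta\in\mathbb T$; a function $F\in H^2(\mathbb M_{m,n})$ is outer if the linear span of $\{Fz^jx:\ j\ge 0,\ x\in\mathbb C^n\}$ is dense in $H^2(\mathbb C^m)$, and $F$ is co-outer if its transpose $F^{\rm t}$ is outer. For $0<r<n$, an $n\times n$ matrix function is called $r$-balanced if it is unitary-valued almost everywhere on $\mathbb T$ and has the form $(\Upsilon\ \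 \overline{\Theta})$, where $\Upsilon$ (of size $n\times r$) and $\Theta$ (of size $n\times(n-r)$) are inner and co-outer and $\overline{\Theta}$ is the entrywise complex conjugate of $\Theta$. **Theorem.** Let $n$ and $r$ be integers with $0<r<n$, and let $\Upsilon$ be an $n\times r$ inner and co-outer matrix function. Then there is an inner and co-outer $n\times(n-r)$ matrix function $\Theta$ such that $$\operatorname{Ker}T_{\Upsilon^{\rm t}}=\Theta H^2(\mathbb C^{n-r})$$ and the matrix function $(\Upsilon\ \ \overline{\Theta})$ is $r$-balanced. -/

import Mathlib

open MeasureTheory AddCircle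
open scoped ENNReal Matrix

noncomputable section

namespace MatrixHardy

/-- Normalized Lebesgue measure on the unit circle `𝕋`. The circle is parametrized by
`t ∈ ℝ / ℤ`, the point being `z = exp (2 π i t)`; thus `fourier k t = z ^ k`. -/
abbrev σ : Measure UnitAddCircle := haarAddCircle

/-- The Hilbert space `L²(ℂⁿ)` on the circle. -/
abbrev L2 (n : ℕ) : Type := Lp (EuclideanSpace ℂ (Fin n)) 2 σ

/-- A function on the circle whose values are `m × n` complex matrices. -/
abbrev MatFun (m n : ℕ) : Type := UnitAddCircle → Matrix (Fin m) (Fin n) ℂ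

/-- `Φ ∈ L^p(𝕄_{m,n})`: all entries are in `L^p`. -/
def MemLpMat {m n : ℕ} (p : ℝ≥0∞) (Φ : MatFun m n) : Prop :=
  ∀ i j, MemLp (fun t => Φ t i j) p σ

/-- `Φ ∈ H^p(𝕄_{m,n})` (for `p ≥ 1`): all entries are in `L^p` and have vanishing Fourier
coefficients of negative index. -/
def MemHpMat {m n : ℕ} (p : ℝ≥0∞) (Φ : MatFun m n) : Prop :=
  MemLpMat p Φ ∧ ∀ i j, ∀ k : ℤ, k < 0 → fourierCoeff (fun t => Φ t i j) k = 0

/-- The pointwise transpose of a matrix function. -/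
def transposeFun {m n : ℕ} (Φ : MatFun m n) : MatFun n m := fun t => (Φ t)ᵀ

theorem MemLpMat.transpose {m n : ℕ} {p : ℝ≥0∞} {Φ : MatFun m n} (h : MemLpMat p Φ) :
    MemLpMat p (transposeFun Φ) := fun i j => h j i

/-! ### The Hardy space `H²(ℂⁿ)` -/

theorem L2.integrable {n : ℕ} (f : L2 n) : Integrable f σ :=
  (Lp.memLp f).integrable (by norm_num)

/-- The `k`-th Fourier coefficient, as a linear map on `L²(ℂⁿ)`. -/
def fourierCoeffLin (n : ℕ) (k : ℤ) : L2 n →ₗ[ℂ] EuclideanSpace ℂ (Fin n) where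
  toFun f := fourierCoeff f k
  map_add' f g := by
    rw [fourierCoeff_congr_ae (Lp.coeFn_add f g),
      fourierCoeff.add (L2.integrable f) (L2.integrable g)]
    rfl
  map_smul' c f := by
    rw [fourierCoeff_congr_ae (Lp.coeFn_smul c f), fourierCoeff.const_smul]
    rfl

theorem continuous_fourierCoeffLin (n : ℕ) (k : ℤ) : Continuous (fourierCoeffLin n k) := by
  refine AddMonoidHomClass.continuous_of_bound (fourierCoeffLin n k) 1 fun f => ?_
  have h1 : ‖fourierCoeff f k‖ ≤ ∫ t, ‖f t‖ ∂σ := by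
    refine (norm_integral_le_integral_norm _).trans_eq ?_
    refine integral_congr_ae (ae_of_all _ fun t => ?_)
    simp only [norm_smul, fourier_apply, Circle.norm_coe, one_mul]
  have h2 : ∫ t, ‖f t‖ ∂σ ≤ ‖f‖ := by
    rw [integral_norm_eq_lintegral_enorm (Lp.aestronglyMeasurable f),
      ← eLpNorm_one_eq_lintegral_enorm, Lp.norm_def]
    exact ENNReal.toReal_mono (Lp.eLpNorm_ne_top f)
      (eLpNorm_le_eLpNorm_of_exponent_le (by norm_num) (Lp.aestronglyMeasurable f))
  rw [one_mul]
  exact h1.trans h2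

/-- The Hardy space `H²(ℂⁿ)`: the functions in `L²(ℂⁿ)` whose Fourier coefficients of negative
index vanish. -/
def H2 (n : ℕ) : Submodule ℂ (L2 n) where
  carrier := {f | ∀ k : ℤ, k < 0 → fourierCoeff f k = 0}
  add_mem' {f g} hf hg k hk := by
    have h := (fourierCoeffLin n k).map_add f g
    exact h.trans (by
      rw [show fourierCoeffLin n k f = 0 from hf k hk,
        show fourierCoeffLin n k g = 0 from hg k hk, add_zero])
  zero_mem' k _ := (fourierCoeffLin n k).map_zero
  smul_mem' c f hf k hk := by
    have h := (fourierCoeffLin n k).map_smul c f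
    exact h.trans (by rw [show fourierCoeffLin n k f = 0 from hf k hk, smul_zero])

theorem isClosed_H2 (n : ℕ) : IsClosed (H2 n : Set (L2 n)) := by
  have h : (H2 n : Set (L2 n)) =
      ⋂ (k : ℤ) (_ : k < 0), {f : L2 n | fourierCoeffLin n k f = 0} := by
    ext f
    simp only [Set.mem_iInter]
    rfl
  rw [h]
  exact isClosed_iInter fun k => isClosed_iInter fun _ =>
    isClosed_eq (continuous_fourierCoeffLin n k) continuous_const

instance (n : ℕ) : CompleteSpace (H2 n) := (isClosed_H2 n).completeSpace_coe

/-! ### Multiplication operators and Toeplitz operators -/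

/-- The pointwise product `Φ f` of a matrix function and a vector function. -/
def mulFun {m n : ℕ} (Φ : MatFun m n) (f : UnitAddCircle → EuclideanSpace ℂ (Fin n)) :
    UnitAddCircle → EuclideanSpace ℂ (Fin m) :=
  fun t => WithLp.toLp 2 (Φ t *ᵥ (f t).ofLp)

theorem memLp_mulFun {m n : ℕ} {Φ : MatFun m n} (hΦ : MemLpMat ∞ Φ) (f : L2 n) :
    MemLp (mulFun Φ f) 2 σ := by
  rw [memLp_piLp_iff]
  intro i
  have h : ∀ j, MemLp (fun t => Φ t i j * f t j) 2 σ := fun j =>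
    MemLp.mul' (memLp_piLp_iff.1 (Lp.memLp f) j) (hΦ i j)
  exact memLp_finsetSum Finset.univ fun j _ => h j

/-- Multiplication by `Φ ∈ L^∞(𝕄_{m,n})`, as an operator `L²(ℂⁿ) → L²(ℂᵐ)`. -/
def mulOp {m n : ℕ} (Φ : MatFun m n) (hΦ : MemLpMat ∞ Φ) : L2 n →ₗ[ℂ] L2 m where
  toFun f := (memLp_mulFun hΦ f).toLp (mulFun Φ f)
  map_add' f g := by
    rw [← MemLp.toLp_add]
    apply MemLp.toLp_congr
    filter_upwards [Lp.coeFn_add f g] with t ht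
    simp only [mulFun, ht, Pi.add_apply, WithLp.ofLp_add, Matrix.mulVec_add, WithLp.toLp_add]
  map_smul' c f := by
    rw [RingHom.id_apply, ← MemLp.toLp_const_smul]
    apply MemLp.toLp_congr
    filter_upwards [Lp.coeFn_smul c f] with t ht
    simp only [mulFun, ht, Pi.smul_apply, WithLp.ofLp_smul, Matrix.mulVec_smul, WithLp.toLp_smul]

/-- The Toeplitz operator `T_Φ : H²(ℂⁿ) → H²(ℂᵐ)`, `T_Φ f = P₊ (Φ f)`, where `P₊` is the
orthogonal projection of `L²(ℂᵐ)` onto `H²(ℂᵐ)`. -/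
def toeplitz {m n : ℕ} (Φ : MatFun m n) (hΦ : MemLpMat ∞ Φ) : H2 n →ₗ[ℂ] H2 m :=
  (H2 m).orthogonalProjectionOnto.toLinearMap ∘ₗ mulOp Φ hΦ ∘ₗ (H2 n).subtype

/-! ### Inner, outer, co-outer and balanced matrix functions -/

/-- `Φ ∈ H^∞(𝕄_{m,n})` is inner if `Φ(ζ)* Φ(ζ) = I_n` for almost all `ζ`. -/
structure IsInner {m n : ℕ} (Φ : MatFun m n) : Prop where
  memHp : MemHpMat ∞ Φ
  isometric : ∀ᵐ t ∂σ, (Φ t)ᴴ * Φ t = 1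

/-- The linear span in `L²(ℂᵐ)` of the functions `F z^j x`, `j ≥ 0`, `x ∈ ℂⁿ`. -/
def polySpan {m n : ℕ} (F : MatFun m n) : Submodule ℂ (L2 m) :=
  Submodule.span ℂ {g | ∃ (j : ℕ) (x : EuclideanSpace ℂ (Fin n)),
    g =ᵐ[σ] mulFun F (fun t => fourier (j : ℤ) t • x)}

/-- `F ∈ H²(𝕄_{m,n})` is outer if the span of the functions `F z^j x` (all of which lie in
`H²(ℂᵐ)`) is dense in `H²(ℂᵐ)`. -/
structure IsOuter {m n : ℕ} (F : MatFun m n) : Prop where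
  memHp : MemHpMat 2 F
  dense : (polySpan F).topologicalClosure = H2 m

/-- `F` is co-outer if its transpose is outer. -/
def IsCoOuter {m n : ℕ} (F : MatFun m n) : Prop := IsOuter (transposeFun F)

/-- The matrix function `(Υ  Θ̄)`, where the bar is entrywise complex conjugation. -/
def conjBlock {n r s : ℕ} (Υ : MatFun n r) (Θ : MatFun n s) :
    UnitAddCircle → Matrix (Fin n) (Fin r ⊕ Fin s) ℂ :=
  fun t => Matrix.fromCols (Υ t) ((Θ t).map star)

/-- For `0 < r < n`, a matrix function `V` with `n` rows and `r + (n - r)` columns is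
`r`-balanced if it is unitary-valued and has the form `(Υ  Θ̄)` with `Υ` (of size `n × r`) and
`Θ` (of size `n × (n - r)`) inner and co-outer. -/
structure IsBalanced {n r : ℕ}
    (V : UnitAddCircle → Matrix (Fin n) (Fin r ⊕ Fin (n - r)) ℂ) : Prop where
  pos : 0 < r
  lt : r < n
  unitary : ∀ᵐ t ∂σ, (V t)ᴴ * V t = 1 ∧ V t * (V t)ᴴ = 1
  form : ∃ (Υ : MatFun n r) (Θ : MatFun n (n - r)),
    IsInner Υ ∧ IsCoOuter Υ ∧ IsInner Θ ∧ IsCoOuter Θ ∧ V =ᵐ[σ] conjBlock Υ Θ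

end MatrixHardy

end

/-! Since `Υᵗ` is analytic, the projection in `T_{Υᵗ}` acts trivially on `Υᵗ f`, so the kernel
consists of the `f` in `H²` with `Υᵗ f = 0` a.e. It is closed and invariant under multiplication by
`z`, so the Beurling–Lax–Halmos theorem (`exists_inner_of_shift_invariant`) writes it as `Θ H²(ℂᵏ)`
with `Θ` inner.

Applying `Θ` to constants gives `Υᵗ Θ = 0`, hence `Υ* Θ̄ = 0`. So `(Υ Θ̄)` is isometric a.e., and `r
+ k ≤ n`. For the reverse inequality, choose `r + 1` rows of `Υ`: the vector of signed `r × r`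
minors is bounded, analytic and annihilated by `Υᵗ`, so its values lie in the range of `Θ(t)`. At a
point where `Υ` has rank `r`, these vectors together with `r` coordinate vectors span `ℂⁿ`. Thus `k
= n - r`, and the square isometric matrix `(Υ Θ̄)` is unitary.

`Θ` is co-outer because the kernel is maximal (`isCoOuter_of_analyticKer_eq`). If `g` in `H²` is
orthogonal to all `Θᵗ zʲ x`, then `Θ z̄ḡ` is analytic and annihilated by `Υᵗ`, so it lies in `Θ H²`.
Injectivity of `Θ` puts `z̄ḡ` in `H²`, which forces `g = 0`. -/

namespace MatrixHardy

open Filter Topology ComplexConjugate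

/-! ### Scalar Fourier analysis and the algebra `H^∞` -/

/-- All Fourier coefficients of negative index vanish. -/
def NonnegSpectrum (f : UnitAddCircle → ℂ) : Prop := ∀ k : ℤ, k < 0 → fourierCoeff f k = 0

/-- The functional `φ ↦ ∫ φ h` is continuous for the sup norm and vanishes on the exponentials,
whose span is dense in the continuous functions. -/
theorem integral_continuousMap_mul_eq_zero {h : UnitAddCircle → ℂ} (hh : Integrable h σ)
    (h0 : ∀ k, fourierCoeff h k = 0) (φ : C(UnitAddCircle, ℂ)) : ∫ t, φ t * h t ∂σ = 0 := by
  have hi : ∀ φ : C(UnitAddCircle, ℂ), Integrable (fun t => φ t * h t) σ := fun φ =>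
    hh.bdd_mul (c := ‖φ‖) φ.continuous.aestronglyMeasurable
      (ae_of_all _ fun t => φ.norm_coe_le_norm t)
  let L : C(UnitAddCircle, ℂ) →ₗ[ℂ] ℂ :=
    { toFun := fun φ => ∫ t, φ t * h t ∂σ
      map_add' := fun φ ψ => by
        rw [← integral_add (hi φ) (hi ψ)]
        simp only [ContinuousMap.add_apply, add_mul]
      map_smul' := fun c φ => by
        rw [RingHom.id_apply, ← integral_smul]
        simp only [ContinuousMap.smul_apply, smul_eq_mul, mul_assoc] }
  have hL : Continuous L := by
    refine AddMonoidHomClass.continuous_of_bound L (∫ t, ‖h t‖ ∂σ) fun φ => ?_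
    refine (norm_integral_le_integral_norm _).trans ?_
    rw [mul_comm, ← integral_const_mul]
    refine integral_mono (hi φ).norm (hh.norm.const_mul _) fun t => ?_
    simp only [norm_mul]
    gcongr
    exact φ.norm_coe_le_norm t
  have hker : (⊤ : Submodule ℂ C(UnitAddCircle, ℂ)) ≤ LinearMap.ker L := by
    rw [← span_fourier_closure_eq_top]
    refine Submodule.topologicalClosure_minimal _ ?_ (isClosed_eq hL continuous_const)
    rw [Submodule.span_le]
    rintro _ ⟨k, rfl⟩
    have := h0 (-k)
    simp only [fourierCoeff, neg_neg, smul_eq_mul] at this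
    exact this
  exact hker (Submodule.mem_top (x := φ))

/-- An integrable function on the circle is determined by its Fourier coefficients. -/
theorem ae_eq_zero_of_fourierCoeff_eq_zero {h : UnitAddCircle → ℂ} (hh : Integrable h σ)
    (h0 : ∀ k, fourierCoeff h k = 0) : h =ᵐ[σ] 0 := by
  refine ae_eq_zero_of_forall_setIntegral_isClosed_eq_zero hh fun s hs => ?_
  rw [← integral_indicator hs.measurableSet]
  -- Continuous functions bounded by 1 that converge pointwise to the indicator of the closed set
  -- `s`.
  let φ : ℕ → C(UnitAddCircle, ℂ) := fun n =>
    ⟨fun t => ((hs.apprSeq n t : NNReal) : ℂ), by fun_prop⟩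
  have hlim : Tendsto (fun n => ∫ t, φ n t * h t ∂σ) atTop (𝓝 (∫ t, s.indicator h t ∂σ)) := by
    refine tendsto_integral_of_dominated_convergence (fun t => ‖h t‖)
      (fun n => (φ n).continuous.aestronglyMeasurable.mul hh.1) hh.norm (fun n => ?_) ?_
    · refine ae_of_all _ fun t => ?_
      rw [norm_mul]
      refine mul_le_of_le_one_left (norm_nonneg _) ?_
      simpa [φ] using HasOuterApproxClosed.apprSeq_apply_le_one hs n t
    · refine ae_of_all _ fun t => ?_
      have h1 := tendsto_pi_nhds.1 (HasOuterApproxClosed.tendsto_apprSeq hs) t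
      have h2 : Tendsto (fun n => φ n t) atTop
          (𝓝 (((s.indicator (fun _ => (1 : NNReal)) t : NNReal) : ℝ) : ℂ)) :=
        (Complex.continuous_ofReal.tendsto _).comp ((NNReal.continuous_coe.tendsto _).comp h1)
      convert h2.mul_const (h t) using 2
      by_cases ht : t ∈ s <;> simp [ht]
  simp only [integral_continuousMap_mul_eq_zero hh h0] at hlim
  exact tendsto_nhds_unique hlim tendsto_const_nhds

theorem fourierCoeff_conj (f : UnitAddCircle → ℂ) (k : ℤ) :
    fourierCoeff (fun t => conj (f t)) k = conj (fourierCoeff f (-k)) := by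
  simp only [fourierCoeff, smul_eq_mul, neg_neg]
  rw [← integral_conj]
  simp only [map_mul, ← fourier_neg]

theorem fourierCoeff_fourier_smul {E : Type*} [NormedAddCommGroup E] [NormedSpace ℂ E]
    (f : UnitAddCircle → E) (j k : ℤ) :
    fourierCoeff (fun t => fourier j t • f t) k = fourierCoeff f (k - j) := by
  simp only [fourierCoeff, smul_smul, ← fourier_add, show -(k - j) = -k + j by ring]

/-- Parseval's identity for the integral of a product. -/
theorem hasSum_integral_mul {f g : UnitAddCircle → ℂ} (hf : MemLp f 2 σ) (hg : MemLp g 2 σ) :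
    HasSum (fun k : ℤ => fourierCoeff f (-k) * fourierCoeff g k) (∫ t, f t * g t ∂σ) := by
  -- The inner product conjugates its first argument, so the bilinear integral of `f g` is the inner
  -- product of `f̄` with `g`.
  have hf' : MemLp (fun t => conj (f t)) 2 σ := hf.star
  have h := fourierBasis.hasSum_inner_mul_inner (hf'.toLp _) (hg.toLp _)
  have h1 : ∀ k : ℤ, fourierCoeff f (-k) * fourierCoeff g k =
      inner ℂ (hf'.toLp _) (fourierBasis k) * inner ℂ (fourierBasis k) (hg.toLp _) := by
    intro k
    rw [← fourierBasis.repr_apply_apply, ← inner_conj_symm (hf'.toLp _), ← fourierBasis.repr_apply_apply,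
      fourierBasis_repr, fourierBasis_repr, fourierCoeff_congr_ae hf'.coeFn_toLp,
      fourierCoeff_congr_ae hg.coeFn_toLp, fourierCoeff_conj, Complex.conj_conj]
  have h2 : ∫ t, f t * g t ∂σ = inner ℂ (hf'.toLp _) (hg.toLp _) := by
    rw [L2.inner_def]
    refine integral_congr_ae ?_
    filter_upwards [hf'.coeFn_toLp, hg.coeFn_toLp] with t h1 h2
    rw [h1, h2, RCLike.inner_apply', Complex.conj_conj]
  rw [h2]
  simp only [h1]
  exact h

/-- By Parseval, the coefficient of index `k` is the sum over `j` of `f̂(k - j) ĝ(j)`. For `k < 0`,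
either `j` or `k - j` is negative, so every term vanishes. -/
theorem NonnegSpectrum.mul {f g : UnitAddCircle → ℂ} (hf : MemLp f 2 σ) (hg : MemLp g 2 σ)
    (hf0 : NonnegSpectrum f) (hg0 : NonnegSpectrum g) :
    NonnegSpectrum (fun t => f t * g t) := by
  intro k hk
  have hF : MemLp (fun t => fourier (-k) t * f t) 2 σ := by
    refine hf.of_le ((map_continuous (fourier (-k))).aestronglyMeasurable.mul hf.1)
      (ae_of_all _ fun t => ?_)
    rw [norm_mul, fourier_apply, Circle.norm_coe, one_mul]
  have h := hasSum_integral_mul hF hg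
  have hz : (fun j : ℤ => fourierCoeff (fun t => fourier (-k) t * f t) (-j) *
      fourierCoeff g j) = fun _ => 0 := by
    funext j
    rcases lt_or_ge j 0 with hj | hj
    · rw [hg0 j hj, mul_zero]
    · have := fourierCoeff_fourier_smul f (-k) (-j)
      simp only [smul_eq_mul] at this
      rw [this, hf0 _ (by omega), zero_mul]
  rw [hz] at h
  have := h.unique hasSum_zero
  simpa only [fourierCoeff, smul_eq_mul, mul_assoc] using this

theorem nonnegSpectrum_const (c : ℂ) : NonnegSpectrum (fun _ => c) := by
  intro k hk
  have h := fourierCoeff.const_mul (fun t : UnitAddCircle => fourier 0 t) c k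
  have h1 : fourierCoeff (fun t : UnitAddCircle => (fourier 0 t : ℂ)) k = 0 := by
    have := congrFun (fourierCoeff_fourier (T := 1) 0) k
    rw [this, Pi.single_eq_of_ne hk.ne]
  rw [h1, mul_zero] at h
  simpa using h

/-- The algebra `H^∞` of the circle. -/
def HInf : Subalgebra ℂ (UnitAddCircle → ℂ) where
  carrier := {f | MemLp f ∞ σ ∧ NonnegSpectrum f}
  mul_mem' {f g} hf hg :=
    ⟨hg.1.mul' hf.1, NonnegSpectrum.mul (hf.1.mono_exponent le_top) (hg.1.mono_exponent le_top)
      hf.2 hg.2⟩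
  add_mem' {f g} hf hg := ⟨hf.1.add hg.1, fun k hk => by
    rw [fourierCoeff.add (hf.1.integrable le_top) (hg.1.integrable le_top), Pi.add_apply, hf.2 k hk, hg.2 k hk,
      add_zero]⟩
  algebraMap_mem' c := ⟨memLp_const c, nonnegSpectrum_const c⟩

theorem det_mem_HInf {ι : Type*} [Fintype ι] [DecidableEq ι]
    {A : UnitAddCircle → Matrix ι ι ℂ} (hA : ∀ i j, (fun t => A t i j) ∈ HInf) :
    (fun t => (A t).det) ∈ HInf := by
  have h : (fun t => (A t).det) = ∑ τ : Equiv.Perm ι, ((Equiv.Perm.sign τ : ℤ) : ℂ) •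
      ∏ i, fun t => A t (τ i) i := by
    funext t
    rw [Matrix.det_apply]
    simp only [Finset.sum_apply, Pi.smul_apply, Finset.prod_apply]
    refine Finset.sum_congr rfl fun τ _ => ?_
    rw [Units.smul_def, zsmul_eq_mul, smul_eq_mul]
  rw [h]
  exact sum_mem fun τ _ => Subalgebra.smul_mem _ (prod_mem fun i _ => hA _ _) _

end MatrixHardy

/-! ### Multiplication operators, shifts and `H²` of vector functions -/

namespace MatrixHardy

open Filter Topology ComplexConjugate

variable {l m n : ℕ}

theorem coeFn_mulOp {Φ : MatFun m n} (hΦ : MemLpMat ∞ Φ) (f : L2 n) :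
    mulOp Φ hΦ f =ᵐ[σ] mulFun Φ f :=
  (memLp_mulFun hΦ f).coeFn_toLp

theorem mulFun_apply (Φ : MatFun m n) (f : UnitAddCircle → EuclideanSpace ℂ (Fin n))
    (t : UnitAddCircle) (i : Fin m) : mulFun Φ f t i = ∑ j, Φ t i j * f t j := rfl

theorem inner_toLp_mulVec (A : Matrix (Fin m) (Fin n) ℂ) (x : EuclideanSpace ℂ (Fin n))
    (y : EuclideanSpace ℂ (Fin m)) :
    inner ℂ y (WithLp.toLp 2 (A *ᵥ x.ofLp)) = inner ℂ (WithLp.toLp 2 (Aᴴ *ᵥ y.ofLp)) x := by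
  simp only [EuclideanSpace.inner_eq_star_dotProduct, Matrix.star_mulVec,
    Matrix.conjTranspose_conjTranspose]
  rw [dotProduct_comm, Matrix.dotProduct_mulVec, dotProduct_comm]

theorem inner_mulFun {Φ : MatFun m n} {t : UnitAddCircle} (h : (Φ t)ᴴ * Φ t = 1)
    (f g : UnitAddCircle → EuclideanSpace ℂ (Fin n)) :
    inner ℂ (mulFun Φ f t) (mulFun Φ g t) = inner ℂ (f t) (g t) := by
  simp only [mulFun, inner_toLp_mulVec, Matrix.mulVec_mulVec, h, Matrix.one_mulVec]

theorem inner_mulOp {Φ : MatFun m n} (hΦ : MemLpMat ∞ Φ) (h : ∀ᵐ t ∂σ, (Φ t)ᴴ * Φ t = 1)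
    (f g : L2 n) : inner ℂ (mulOp Φ hΦ f) (mulOp Φ hΦ g) = inner ℂ f g := by
  rw [L2.inner_def, L2.inner_def]
  refine integral_congr_ae ?_
  filter_upwards [h, coeFn_mulOp hΦ f, coeFn_mulOp hΦ g] with t ht h1 h2
  rw [h1, h2, inner_mulFun ht]

/-- Multiplication by an isometry-valued matrix function, as a linear isometry. -/
noncomputable def mulIsom (Φ : MatFun m n) (hΦ : MemLpMat ∞ Φ)
    (h : ∀ᵐ t ∂σ, (Φ t)ᴴ * Φ t = 1) : L2 n →ₗᵢ[ℂ] L2 m :=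
  (mulOp Φ hΦ).isometryOfInner (inner_mulOp hΦ h)

theorem MemLpMat.conjTranspose {p : ℝ≥0∞} {Φ : MatFun m n} (h : MemLpMat p Φ) :
    MemLpMat p (fun t => (Φ t)ᴴ) := fun i j => (h j i).star

theorem inner_mulOp_right {Φ : MatFun m n} (hΦ : MemLpMat ∞ Φ) (f : L2 n) (g : L2 m) :
    inner ℂ g (mulOp Φ hΦ f) = inner ℂ (mulOp (fun t => (Φ t)ᴴ) hΦ.conjTranspose g) f := by
  rw [L2.inner_def, L2.inner_def]
  refine integral_congr_ae ?_
  filter_upwards [coeFn_mulOp hΦ f, coeFn_mulOp hΦ.conjTranspose g] with t h1 h2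
  rw [h1, h2, mulFun, mulFun, inner_toLp_mulVec]

/-- The scalar matrix function `z ^ j`. -/
noncomputable def monomial (n : ℕ) (j : ℤ) : MatFun n n := fun t => fourier j t • 1

theorem mulFun_monomial (j : ℤ) (f : UnitAddCircle → EuclideanSpace ℂ (Fin n)) :
    mulFun (monomial n j) f = fun t => fourier j t • f t := by
  funext t
  simp only [mulFun, monomial, Matrix.smul_mulVec, Matrix.one_mulVec, WithLp.toLp_smul,
    WithLp.toLp_ofLp]

theorem conj_fourier_mul_self (j : ℤ) (t : UnitAddCircle) :
    conj (fourier j t : ℂ) * fourier j t = 1 := by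
  rw [← fourier_neg, ← fourier_add, neg_add_cancel, fourier_zero]

theorem memLpMat_monomial (j : ℤ) : MemLpMat ∞ (monomial n j) := by
  intro a b
  refine memLp_top_of_bound (C := 1)
    (((map_continuous (fourier j)).mul continuous_const).aestronglyMeasurable)
    (ae_of_all _ fun t => ?_)
  simp only [monomial, Matrix.smul_apply, smul_eq_mul, norm_mul, fourier_apply, Circle.norm_coe,
    one_mul, Matrix.one_apply]
  split_ifs <;> simp

theorem monomial_isometric (j : ℤ) : ∀ᵐ t ∂σ, (monomial n j t)ᴴ * monomial n j t = 1 := by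
  refine ae_of_all _ fun t => ?_
  simp only [monomial, Matrix.conjTranspose_smul, Matrix.conjTranspose_one,
    Matrix.mul_smul, Matrix.mul_one, smul_smul]
  rw [mul_comm, show star (fourier j t : ℂ) = conj (fourier j t : ℂ) from rfl,
    conj_fourier_mul_self, one_smul]

/-- Multiplication by `z ^ j` on `L²(ℂⁿ)`. -/
noncomputable def shift (n : ℕ) (j : ℤ) : L2 n →ₗᵢ[ℂ] L2 n :=
  mulIsom (monomial n j) (memLpMat_monomial j) (monomial_isometric j)

theorem coeFn_shift (j : ℤ) (f : L2 n) : shift n j f =ᵐ[σ] fun t => fourier j t • f t := by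
  rw [← mulFun_monomial]
  exact coeFn_mulOp (memLpMat_monomial j) f

theorem shift_shift (i j : ℤ) (f : L2 n) : shift n i (shift n j f) = shift n (i + j) f := by
  refine Lp.ext ?_
  filter_upwards [coeFn_shift i (shift n j f), coeFn_shift j f, coeFn_shift (i + j) f]
    with t h1 h2 h3
  rw [h1, h2, h3, smul_smul, fourier_add]

theorem shift_zero (f : L2 n) : shift n 0 f = f := by
  refine Lp.ext ?_
  filter_upwards [coeFn_shift 0 f] with t h1
  rw [h1, fourier_zero, one_smul]

theorem inner_shift (j : ℤ) (f g : L2 n) :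
    inner ℂ (shift n j f) g = inner ℂ f (shift n (-j) g) := by
  rw [← (shift n (-j)).inner_map_map, shift_shift, neg_add_cancel, shift_zero]

theorem mulOp_shift {Φ : MatFun m n} (hΦ : MemLpMat ∞ Φ) (j : ℤ) (f : L2 n) :
    mulOp Φ hΦ (shift n j f) = shift m j (mulOp Φ hΦ f) := by
  refine Lp.ext ?_
  filter_upwards [coeFn_mulOp hΦ (shift n j f), coeFn_shift j f, coeFn_mulOp hΦ f,
    coeFn_shift j (mulOp Φ hΦ f)] with t h1 h2 h3 h4
  rw [h1, h4, h3]
  simp only [mulFun, h2, WithLp.ofLp_smul, Matrix.mulVec_smul, WithLp.toLp_smul]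

theorem fourierCoeff_shift (j k : ℤ) (f : L2 n) :
    fourierCoeff (shift n j f) k = fourierCoeff f (k - j) := by
  rw [fourierCoeff_congr_ae (coeFn_shift j f), fourierCoeff_fourier_smul]

theorem memLp_coord (f : L2 n) (i : Fin n) : MemLp (fun t => f t i) 2 σ :=
  memLp_piLp_iff.1 (Lp.memLp f) i

theorem integrable_coord (f : L2 n) (i : Fin n) : Integrable (fun t => f t i) σ :=
  (memLp_coord f i).integrable (by norm_num)

theorem fourierCoeff_coord (f : L2 n) (k : ℤ) (i : Fin n) :
    fourierCoeff f k i = fourierCoeff (fun t => f t i) k := by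
  rw [fourierCoeff, eval_integral_piLp]
  · rfl
  · exact fun j => (integrable_coord f j).fourier_smul (-k)

theorem mem_H2_iff {f : L2 n} : f ∈ H2 n ↔ ∀ i, NonnegSpectrum fun t => f t i := by
  constructor
  · intro h i k hk
    rw [← fourierCoeff_coord, show fourierCoeff f k = 0 from h k hk]
    rfl
  · intro h k hk
    ext i
    rw [fourierCoeff_coord, h i k hk]
    rfl

theorem eq_zero_of_fourierCoeff_eq_zero {f : L2 n} (h : ∀ k, fourierCoeff f k = 0) : f = 0 := by
  have h1 : ∀ᵐ t ∂σ, ∀ i, f t i = 0 := by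
    rw [ae_all_iff]
    intro i
    refine ae_eq_zero_of_fourierCoeff_eq_zero (integrable_coord f i) fun k => ?_
    rw [← fourierCoeff_coord, h k]
    rfl
  refine Lp.ext ?_
  filter_upwards [h1, Lp.coeFn_zero (EuclideanSpace ℂ (Fin n)) 2 σ] with t h2 h3
  rw [h3]
  ext i
  exact h2 i

/-- The constant function `x`, as an element of `L²(ℂⁿ)`. -/
noncomputable def constL2 (x : EuclideanSpace ℂ (Fin n)) : L2 n := (memLp_const x).toLp _

theorem coeFn_constL2 (x : EuclideanSpace ℂ (Fin n)) : constL2 x =ᵐ[σ] fun _ => x :=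
  (memLp_const x).coeFn_toLp

theorem inner_constL2 (x : EuclideanSpace ℂ (Fin n)) (f : L2 n) :
    inner ℂ (constL2 x) f = inner ℂ x (fourierCoeff f 0) := by
  rw [L2.inner_def, fourierCoeff]
  simp only [neg_zero, fourier_zero, one_smul]
  rw [← integral_inner f.integrable]
  refine integral_congr_ae ?_
  filter_upwards [coeFn_constL2 x] with t h1
  rw [h1]

theorem inner_shift_constL2 (j : ℤ) (x : EuclideanSpace ℂ (Fin n)) (f : L2 n) :
    inner ℂ (shift n j (constL2 x)) f = inner ℂ x (fourierCoeff f j) := by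
  rw [inner_shift, inner_constL2, fourierCoeff_shift, zero_sub, neg_neg]

theorem fourierCoeff_eq_zero_of_inner {j : ℤ} {f : L2 n}
    (h : ∀ x, inner ℂ (shift n j (constL2 x)) f = 0) : fourierCoeff f j = 0 := by
  have := h (fourierCoeff f j)
  rwa [inner_shift_constL2, inner_self_eq_zero] at this

theorem shift_mem_H2 {j : ℤ} (hj : 0 ≤ j) {f : L2 n} (hf : f ∈ H2 n) : shift n j f ∈ H2 n := by
  intro k hk
  rw [fourierCoeff_shift]
  exact hf _ (by omega)

theorem constL2_mem_H2 (x : EuclideanSpace ℂ (Fin n)) : constL2 x ∈ H2 n := by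
  rw [mem_H2_iff]
  intro i k hk
  rw [← nonnegSpectrum_const (x i) k hk]
  refine congrFun (fourierCoeff_congr_ae ?_) k
  filter_upwards [coeFn_constL2 x] with t h1
  rw [h1]

theorem mulOp_mem_H2 {Φ : MatFun m n} (hΦ : MemHpMat ∞ Φ) {f : L2 n} (hf : f ∈ H2 n) :
    mulOp Φ hΦ.1 f ∈ H2 m := by
  rw [mem_H2_iff] at hf ⊢
  intro i k hk
  have h1 : (fun t => mulOp Φ hΦ.1 f t i) =ᵐ[σ] ∑ j, fun t => Φ t i j * f t j := by
    filter_upwards [coeFn_mulOp hΦ.1 f] with t h1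
    rw [h1, mulFun_apply, Finset.sum_apply]
  have h2 : ∀ j, MemLp (fun t => Φ t i j) 2 σ := fun j => (hΦ.1 i j).mono_exponent le_top
  rw [fourierCoeff_congr_ae h1, fourierCoeff.sum, Finset.sum_apply]
  · refine Finset.sum_eq_zero fun j _ => ?_
    exact NonnegSpectrum.mul (h2 j) (memLp_coord f j) (hΦ.2 i j) (hf j) k hk
  · exact fun j _ => (h2 j).integrable_mul (memLp_coord f j)

/-- A closed subspace containing all analytic monomials contains `H²`. -/
theorem H2_le_of_monomials {P : Submodule ℂ (L2 n)} (hP : IsClosed (P : Set (L2 n)))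
    (h : ∀ (j : ℕ) x, shift n j (constL2 x) ∈ P) : H2 n ≤ P := by
  -- Work with `P ⊓ H²`: a vector of `H²` orthogonal to it has no negative coefficients, and the
  -- monomials annihilate the others.
  have hc : IsClosed ((P ⊓ H2 n : Submodule ℂ (L2 n)) : Set (L2 n)) := hP.inter (isClosed_H2 n)
  have : CompleteSpace (P ⊓ H2 n : Submodule ℂ (L2 n)) := hc.completeSpace_coe
  have h0 := Submodule.sup_orthogonal_inf_of_hasOrthogonalProjection
    (inf_le_right : P ⊓ H2 n ≤ H2 n)
  have hb : (P ⊓ H2 n)ᗮ ⊓ H2 n = ⊥ := by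
    rw [eq_bot_iff]
    rintro f ⟨hf1, hf2⟩
    rw [Submodule.mem_bot]
    refine eq_zero_of_fourierCoeff_eq_zero fun k => ?_
    rcases lt_or_ge k 0 with hk | hk
    · exact hf2 k hk
    · lift k to ℕ using hk
      exact fourierCoeff_eq_zero_of_inner fun x => (Submodule.mem_orthogonal _ f).1 hf1 _
        ⟨h k x, shift_mem_H2 (by omega) (constL2_mem_H2 x)⟩
  rw [hb, sup_bot_eq] at h0
  exact h0 ▸ inf_le_left

end MatrixHardy

/-! ### Wandering subspaces and the Beurling–Lax–Halmos theorem -/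

namespace MatrixHardy

open Filter Topology ComplexConjugate

variable {n : ℕ}

/-- If `e` is orthogonal to `z ^ j f` for all `j ≠ 0`, then the pointwise inner product of `e` and
`f` is constant. -/
theorem inner_ae_eq_const {e f : L2 n} (h : ∀ j : ℤ, j ≠ 0 → inner ℂ e (shift n j f) = 0) :
    ∀ᵐ t ∂σ, inner ℂ (e t) (f t) = inner ℂ e f := by
  have hi : Integrable (fun t => inner ℂ (e t) (f t)) σ := L2.integrable_inner e f
  have hi' : Integrable (fun t => inner ℂ (e t) (f t) + -inner ℂ e f) σ :=
    hi.add (integrable_const _)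
  have hc : ∀ j, fourierCoeff (fun t => inner ℂ (e t) (f t)) j = inner ℂ e (shift n (-j) f) := by
    intro j
    rw [L2.inner_def, fourierCoeff]
    refine integral_congr_ae ?_
    filter_upwards [coeFn_shift (-j) f] with t ht
    rw [ht, inner_smul_right, smul_eq_mul]
  have h0 : (fun t => inner ℂ (e t) (f t) + -inner ℂ e f) =ᵐ[σ] 0 := by
    refine ae_eq_zero_of_fourierCoeff_eq_zero hi' fun j => ?_
    have h1 := fourierCoeff.add hi (integrable_const (-inner ℂ e f))
    have h2 := congrFun h1 j
    refine h2.trans ?_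
    rw [Pi.add_apply, hc]
    rcases eq_or_ne j 0 with rfl | hj
    · rw [neg_zero, shift_zero]
      simp [fourierCoeff]
    · rw [h _ (neg_ne_zero.2 hj), zero_add]
      have h3 := fourierCoeff.const_mul (fun t : UnitAddCircle => fourier 0 t) (-inner ℂ e f) j
      have h4 := congrFun (fourierCoeff_fourier (T := 1) 0) j
      rw [Pi.single_eq_of_ne hj] at h4
      rw [h4, mul_zero] at h3
      simpa using h3
  filter_upwards [h0] with t ht
  exact add_neg_eq_zero.1 ht

/-- The wandering subspace `K ⊖ z K`. -/
noncomputable def wandering (K : Submodule ℂ (L2 n)) : Submodule ℂ (L2 n) :=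
  K ⊓ (K.map (shift n 1).toLinearMap)ᗮ

theorem shift_mem {K : Submodule ℂ (L2 n)} (hz : ∀ f ∈ K, shift n 1 f ∈ K) (j : ℕ) {f : L2 n}
    (hf : f ∈ K) : shift n j f ∈ K := by
  induction j with
  | zero => simpa only [Nat.cast_zero, shift_zero] using hf
  | succ j ih =>
    have := hz _ ih
    rwa [shift_shift, add_comm] at this

theorem inner_shift_wandering {K : Submodule ℂ (L2 n)} (hz : ∀ f ∈ K, shift n 1 f ∈ K)
    {e f : L2 n} (he : e ∈ wandering K) (hf : f ∈ wandering K) {j : ℤ} (hj : j ≠ 0) :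
    inner ℂ e (shift n j f) = 0 := by
  have key : ∀ {e f : L2 n}, e ∈ wandering K → f ∈ K → ∀ j : ℕ,
      inner ℂ e (shift n ((j : ℤ) + 1) f) = 0 := by
    intro e f he hf j
    refine Submodule.inner_left_of_mem_orthogonal (K := K.map (shift n 1).toLinearMap) ?_ he.2
    refine ⟨shift n j f, shift_mem hz j hf, ?_⟩
    change shift n 1 (shift n j f) = _
    rw [shift_shift, add_comm]
  rcases lt_or_gt_of_ne hj with h | h
  · obtain ⟨i, rfl⟩ : ∃ i : ℕ, j = -((i : ℤ) + 1) := ⟨(-j - 1).toNat, by omega⟩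
    rw [← inner_shift, ← inner_conj_symm, key hf he.1, map_zero]
  · obtain ⟨i, rfl⟩ : ∃ i : ℕ, j = (i : ℤ) + 1 := ⟨(j - 1).toNat, by omega⟩
    exact key he hf.1 i

/-- Inner products of wandering vectors are constant on the circle, so orthonormality in `L²`
becomes orthonormality of the values at almost every point. -/
theorem wandering_orthonormal_ae {K : Submodule ℂ (L2 n)} (hz : ∀ f ∈ K, shift n 1 f ∈ K)
    {ι : Type*} [Fintype ι] {b : ι → L2 n} (hb : ∀ a, b a ∈ wandering K) (ho : Orthonormal ℂ b) :
    ∀ᵐ t ∂σ, Orthonormal ℂ fun a => b a t := by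
  classical
  have h : ∀ᵐ t ∂σ, ∀ a c, inner ℂ (b a t) (b c t) = inner ℂ (b a) (b c) := by
    rw [ae_all_iff]
    intro a
    rw [ae_all_iff]
    intro c
    exact inner_ae_eq_const fun j hj => inner_shift_wandering hz (hb a) (hb c) hj
  filter_upwards [h] with t ht
  rw [orthonormal_iff_ite] at ho ⊢
  intro a c
  rw [ht, ho]

/-- An orthonormal family of wandering vectors has orthonormal values in `ℂⁿ` at some point, hence
at most `n` members. -/
theorem finiteDimensional_wandering {K : Submodule ℂ (L2 n)} (hz : ∀ f ∈ K, shift n 1 f ∈ K) :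
    FiniteDimensional ℂ (wandering K) := by
  have h : Module.rank ℂ (wandering K) ≤ n := by
    refine rank_le fun s hs => ?_
    let S := Submodule.span ℂ (s : Set (wandering K))
    let b := stdOrthonormalBasis ℂ S
    have hd : Module.finrank ℂ S = s.card := by
      rw [finrank_span_set_eq_card (s := (s : Set (wandering K))) hs]
      simp
    have ho : Orthonormal ℂ fun a => (((b a : S) : wandering K) : L2 n) :=
      (b.orthonormal.comp_linearIsometry S.subtypeₗᵢ).comp_linearIsometry
        (wandering K).subtypeₗᵢ
    obtain ⟨t, ht⟩ := (wandering_orthonormal_ae hz (fun a => (b a : wandering K).2) ho).exists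
    have := ht.linearIndependent.fintype_card_le_finrank
    rwa [Fintype.card_fin, hd, finrank_euclideanSpace_fin] at this
  exact Module.rank_lt_aleph0_iff.1 (h.trans_lt Cardinal.natCast_lt_aleph0)

/-- The matrix function with columns `b a`. -/
noncomputable def ofCols {k : ℕ} (b : Fin k → L2 n) : MatFun n k := fun t i a => b a t i

theorem isInner_ofCols {k : ℕ} {b : Fin k → L2 n} (hb : ∀ a, b a ∈ H2 n)
    (ho : ∀ᵐ t ∂σ, Orthonormal ℂ fun a => b a t) : IsInner (ofCols b) := by
  refine ⟨⟨fun i a => ?_, fun i a => mem_H2_iff.1 (hb a) i⟩, ?_⟩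
  · refine memLp_top_of_bound (memLp_coord (b a) i).1 1 ?_
    filter_upwards [ho] with t ht
    exact (PiLp.norm_apply_le (b a t) i).trans (ht.1 a).le
  · filter_upwards [ho] with t ht
    ext a c
    have := orthonormal_iff_ite.1 ht a c
    rw [Matrix.one_apply, ← this, Matrix.mul_apply, PiLp.inner_apply]
    simp only [RCLike.inner_apply', Matrix.conjTranspose_apply]
    rfl

theorem mulOp_ofCols_constL2 {k : ℕ} {b : Fin k → L2 n} (hΘ : MemLpMat ∞ (ofCols b))
    (x : EuclideanSpace ℂ (Fin k)) : mulOp (ofCols b) hΘ (constL2 x) = ∑ a, x a • b a := by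
  refine Lp.ext ?_
  have h1 : ∀ᵐ t ∂σ, ∀ a, (x a • b a : L2 n) t = x a • b a t :=
    ae_all_iff.2 fun a => Lp.coeFn_smul _ _
  filter_upwards [coeFn_mulOp hΘ (constL2 x), coeFn_constL2 x, h1,
    Lp.coeFn_finsetSum Finset.univ fun a => x a • b a] with t h1 h2 h3 h4
  rw [h1, h4]
  ext i
  rw [mulFun_apply, h2]
  simp only [Finset.sum_apply, h3, WithLp.ofLp_sum, WithLp.ofLp_smul, Pi.smul_apply, smul_eq_mul]
  exact Finset.sum_congr rfl fun a _ => mul_comm _ _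

/-- The Beurling–Lax–Halmos theorem: a closed shift-invariant subspace of `H²(ℂⁿ)` is of the form
`Θ H²(ℂᵏ)` for an inner matrix function `Θ`. -/
theorem exists_inner_of_shift_invariant {K : Submodule ℂ (L2 n)}
    (hK : IsClosed (K : Set (L2 n))) (hKH : K ≤ H2 n) (hz : ∀ f ∈ K, shift n 1 f ∈ K) :
    ∃ (k : ℕ) (Θ : MatFun n k) (hΘ : IsInner Θ), K = (H2 k).map (mulOp Θ hΘ.memHp.1) := by
  have hfd := finiteDimensional_wandering hz
  let b' := stdOrthonormalBasis ℂ (wandering K)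
  let b := fun a => (b' a : L2 n)
  have hbW : ∀ a, b a ∈ wandering K := fun a => (b' a).2
  have ho : Orthonormal ℂ b := b'.orthonormal.comp_linearIsometry (wandering K).subtypeₗᵢ
  have hΘ : IsInner (ofCols b) :=
    isInner_ofCols (fun a => hKH (hbW a).1) (wandering_orthonormal_ae hz hbW ho)
  refine ⟨_, ofCols b, hΘ, ?_⟩
  let J := mulIsom (ofCols b) hΘ.memHp.1 hΘ.isometric
  have hle : (H2 _).map (mulOp (ofCols b) hΘ.memHp.1) ≤ K := by
    rw [Submodule.map_le_iff_le_comap]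
    refine H2_le_of_monomials (hK.preimage J.continuous) fun j x => ?_
    rw [Submodule.mem_comap, mulOp_shift, mulOp_ofCols_constL2]
    exact shift_mem hz j (Submodule.sum_mem _ fun a _ => Submodule.smul_mem _ _ (hbW a).1)
  have hRc : IsClosed (((H2 _).map (mulOp (ofCols b) hΘ.memHp.1) : Submodule ℂ (L2 n)) :
      Set (L2 n)) := J.isometry.isClosedEmbedding.isClosedMap _ (isClosed_H2 _)
  have := hRc.completeSpace_coe
  have hsup := Submodule.sup_orthogonal_inf_of_hasOrthogonalProjection hle
  have hzc : IsClosed ((K.map (shift n 1).toLinearMap : Submodule ℂ (L2 n)) : Set (L2 n)) :=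
    (shift n 1).isometry.isClosedEmbedding.isClosedMap _ hK
  have := hzc.completeSpace_coe
  have hzsup := Submodule.sup_orthogonal_inf_of_hasOrthogonalProjection
    (show K.map (shift n 1).toLinearMap ≤ K by rintro _ ⟨f, hf, rfl⟩; exact hz f hf)
  have hbot : ((H2 _).map (mulOp (ofCols b) hΘ.memHp.1))ᗮ ⊓ K = ⊥ := by
    rw [eq_bot_iff]
    rintro f ⟨hf1, hf2⟩
    rw [Submodule.mem_bot]
    have hf3 : ∀ (j : ℕ) (e : L2 n), e ∈ wandering K → inner ℂ (shift n j e) f = 0 := by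
      intro j e he
      refine Submodule.inner_right_of_mem_orthogonal ?_ hf1
      refine ⟨shift _ j (constL2 (b'.repr ⟨e, he⟩)),
        shift_mem_H2 (by omega) (constL2_mem_H2 _), ?_⟩
      rw [mulOp_shift, mulOp_ofCols_constL2]
      congr 1
      have := congrArg (wandering K).subtype (b'.sum_repr ⟨e, he⟩)
      simpa only [map_sum, map_smul, Submodule.subtype_apply] using this
    -- Such an `f` lies in every `zʲ K`: writing `f = zʲ g`, orthogonality to `zʲ` times the
    -- wandering part of `g` kills that part, so `g ∈ z K`.
    have hind : ∀ j : ℕ, ∃ g ∈ K, shift n j g = f := by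
      intro j
      induction j with
      | zero => exact ⟨f, hf2, shift_zero f⟩
      | succ j ih =>
        obtain ⟨g, hg, rfl⟩ := ih
        rw [← hzsup] at hg
        obtain ⟨g1, hg1, g2, hg2, rfl⟩ := Submodule.mem_sup.1 hg
        have h1 := hf3 j g2 ⟨hg2.2, hg2.1⟩
        rw [(shift n j).inner_map_map, inner_add_right,
          Submodule.inner_left_of_mem_orthogonal hg1 hg2.1, zero_add, inner_self_eq_zero] at h1
        obtain ⟨g3, hg3, rfl⟩ := hg1
        refine ⟨g3, hg3, ?_⟩
        change _ = shift n j (shift n 1 g3 + g2)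
        rw [h1, add_zero, shift_shift]
        norm_cast
    refine eq_zero_of_fourierCoeff_eq_zero fun k => ?_
    -- This exponent exceeds `k`, so the coefficient of `f` at `k` is one of `g` at a negative
    -- index.
    obtain ⟨g, hg, rfl⟩ := hind (k + 1).toNat
    rw [fourierCoeff_shift]
    exact hKH hg _ (by omega)
  rw [hbot, sup_bot_eq] at hsup
  exact hsup.symm

end MatrixHardy

/-! ### Maximal minors and the pointwise dimension count -/

namespace MatrixHardy

variable {n r k : ℕ}

/-- The vector of signed maximal minors of the rows `s i` of `A`, which lies in the kernel of
`Aᵀ`. -/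
noncomputable def minorVec (A : Matrix (Fin n) (Fin r) ℂ) (s : Fin (r + 1) → Fin n) : Fin n → ℂ :=
  ∑ i, Pi.single (s i) ((-1) ^ (i : ℕ) * (A.submatrix (s ∘ i.succAbove) id).det)

theorem transpose_mulVec_minorVec (A : Matrix (Fin n) (Fin r) ℂ) (s : Fin (r + 1) → Fin n) :
    Aᵀ *ᵥ minorVec A s = 0 := by
  funext c
  -- The chosen rows with column `c` repeated in front; expanding the vanishing determinant along
  -- that column gives entry `c` of the product.
  let M : Matrix (Fin (r + 1)) (Fin (r + 1)) ℂ := fun i => Fin.cons (A (s i) c) (A (s i))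
  have hM : M.det = 0 := Matrix.det_zero_of_column_eq (i := 0) (j := c.succ)
    (Fin.succ_ne_zero c).symm fun i => rfl
  rw [Matrix.det_succ_column_zero] at hM
  rw [minorVec, Matrix.mulVec_sum, Finset.sum_apply, Pi.zero_apply, ← hM]
  refine Finset.sum_congr rfl fun i _ => ?_
  rw [Matrix.mulVec_single]
  simp only [Matrix.transpose_apply, Pi.smul_apply, MulOpposite.smul_eq_mul_unop,
    MulOpposite.unop_op, Matrix.col_apply]
  have h1 : M.submatrix i.succAbove Fin.succ = A.submatrix (s ∘ i.succAbove) id := rfl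
  have h2 : M i 0 = A (s i) c := rfl
  rw [h1, h2]
  ring

theorem exists_minor_ne_zero {A : Matrix (Fin n) (Fin r) ℂ} (hA : Aᴴ * A = 1) :
    ∃ s : Fin r → Fin n, (A.submatrix s id).det ≠ 0 := by
  have h1 : A.rank = r := by
    have h := Matrix.rank_mul_le_right Aᴴ A
    rw [hA, Matrix.rank_one, Fintype.card_fin] at h
    exact le_antisymm ((Matrix.rank_le_card_width A).trans_eq (Fintype.card_fin r)) h
  rw [Matrix.rank_eq_finrank_span_row] at h1
  obtain ⟨f, hf, -, hli⟩ := Submodule.exists_fun_fin_finrank_span_eq ℂ (Set.range A.row)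
  have hrow : ∀ i, ∃ x, A.row x = f i := fun i => hf i
  choose g hg using hrow
  refine ⟨g ∘ Fin.cast h1.symm, ?_⟩
  have h2 : LinearIndependent ℂ (A.submatrix (g ∘ Fin.cast h1.symm) id).row := by
    have h3 : (A.submatrix (g ∘ Fin.cast h1.symm) id).row = f ∘ Fin.cast h1.symm := by
      funext i
      exact hg _
    rw [h3]
    exact hli.comp _ (Fin.cast_injective _)
  exact ((Matrix.isUnit_iff_isUnit_det _).1 (Matrix.linearIndependent_rows_iff_isUnit.1 h2)).ne_zero

/-- If `A` has full column rank and all its minor vectors are in the range of `B`, then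
`B` has at least `n - r` columns. -/
theorem le_add_of_minorVec_mem_range {A : Matrix (Fin n) (Fin r) ℂ} {B : Matrix (Fin n) (Fin k) ℂ}
    (hA : Aᴴ * A = 1) (h : ∀ s, minorVec A s ∈ LinearMap.range B.mulVecLin) : n ≤ r + k := by
  obtain ⟨s₀, hs₀⟩ := exists_minor_ne_zero hA
  let S := Submodule.span ℂ (Set.range fun j => (Pi.single (s₀ j) 1 : Fin n → ℂ))
  have hsingle : ∀ x, (Pi.single x 1 : Fin n → ℂ) ∈ S ⊔ LinearMap.range B.mulVecLin := by
    intro x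
    -- Modulo `S`, this minor vector is the nonzero minor on the rows `s₀` times the coordinate
    -- vector at `x`.
    have h1 := h (Fin.cons x s₀)
    have h2 : ∀ j c, (Pi.single (s₀ j) c : Fin n → ℂ) ∈ S := by
      intro j c
      have : (Pi.single (s₀ j) c : Fin n → ℂ) = c • Pi.single (s₀ j) 1 := by
        rw [← Pi.single_smul', smul_eq_mul, mul_one]
      rw [this]
      exact S.smul_mem _ (Submodule.subset_span ⟨j, rfl⟩)
    rw [minorVec, Fin.sum_univ_succ] at h1
    have h3 : (Fin.cons x s₀ : Fin (r + 1) → Fin n) ∘ (0 : Fin (r + 1)).succAbove = s₀ := by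
      funext j
      simp
    simp only [Fin.cons_zero, Fin.val_zero, pow_zero, one_mul, Fin.cons_succ] at h1
    rw [h3] at h1
    have h4 := (Submodule.add_mem_iff_left _ (Submodule.mem_sup_left
      (Submodule.sum_mem S fun j _ => h2 j _))).1 (Submodule.mem_sup_right (S := S) h1)
    have h5 := Submodule.smul_mem _ (A.submatrix s₀ id).det⁻¹ h4
    rwa [← Pi.single_smul', smul_eq_mul, inv_mul_cancel₀ hs₀] at h5
  have htop : S ⊔ LinearMap.range B.mulVecLin = ⊤ := by
    rw [eq_top_iff, ← (Pi.basisFun ℂ (Fin n)).span_eq, Submodule.span_le]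
    rintro _ ⟨x, rfl⟩
    rw [Pi.basisFun_apply]
    exact hsingle x
  have h1 := Submodule.finrank_add_le_finrank_add_finrank S (LinearMap.range B.mulVecLin)
  rw [htop, finrank_top, Module.finrank_fin_fun] at h1
  have h2 : Module.finrank ℂ S ≤ r :=
    (finrank_range_le_card _).trans_eq (Fintype.card_fin r)
  have h3 : Module.finrank ℂ (LinearMap.range B.mulVecLin) ≤ k :=
    (Matrix.rank_le_card_width B).trans_eq (Fintype.card_fin k)
  omega

theorem minorVec_mem_HInf {Φ : MatFun n r} (hΦ : MemHpMat ∞ Φ) (s : Fin (r + 1) → Fin n)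
    (x : Fin n) : (fun t => minorVec (Φ t) s x) ∈ HInf := by
  have h : (fun t => minorVec (Φ t) s x) = ∑ i, (if x = s i then (-1 : ℂ) ^ (i : ℕ) else 0) •
      fun t => ((Φ t).submatrix (s ∘ i.succAbove) id).det := by
    funext t
    simp only [minorVec, Finset.sum_apply, Pi.smul_apply, Pi.single_apply, smul_eq_mul, ite_mul,
      zero_mul]
  rw [h]
  refine sum_mem fun i _ => Subalgebra.smul_mem _ (det_mem_HInf fun a c => ?_) _
  exact ⟨hΦ.1 _ _, hΦ.2 _ _⟩

theorem memLp_minorVec {Φ : MatFun n r} (hΦ : MemHpMat ∞ Φ) (s : Fin (r + 1) → Fin n) :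
    MemLp (fun t => WithLp.toLp 2 (minorVec (Φ t) s)) 2 σ :=
  memLp_piLp_iff.2 fun x => (minorVec_mem_HInf hΦ s x).1.mono_exponent le_top

end MatrixHardy

/-! ### The analytic kernel, the number of columns and co-outerness -/

namespace MatrixHardy

open ComplexConjugate

variable {n r k m : ℕ}

theorem MemHpMat.transpose {p : ℝ≥0∞} {Φ : MatFun m n} (h : MemHpMat p Φ) :
    MemHpMat p (transposeFun Φ) := ⟨h.1.transpose, fun i j => h.2 j i⟩

theorem MemHpMat.two {Φ : MatFun m n} (h : MemHpMat ∞ Φ) : MemHpMat 2 Φ :=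
  ⟨fun i j => (h.1 i j).mono_exponent le_top, h.2⟩

theorem mulOp_eq_zero_iff {Φ : MatFun m n} (hΦ : MemLpMat ∞ Φ) (f : L2 n) :
    mulOp Φ hΦ f = 0 ↔ ∀ᵐ t ∂σ, Φ t *ᵥ (f t).ofLp = 0 := by
  rw [Lp.eq_zero_iff_ae_eq_zero]
  have h : ∀ᵐ t ∂σ, mulOp Φ hΦ f t = 0 ↔ Φ t *ᵥ (f t).ofLp = 0 := by
    filter_upwards [coeFn_mulOp hΦ f] with t ht
    rw [ht, mulFun, WithLp.toLp_eq_zero]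
  exact Filter.eventually_congr h

/-- The analytic functions annihilated by a bounded matrix function. -/
noncomputable def analyticKer (Φ : MatFun m n) (hΦ : MemLpMat ∞ Φ) : Submodule ℂ (L2 n) :=
  H2 n ⊓ LinearMap.ker (mulOp Φ hΦ)

theorem mem_analyticKer {Φ : MatFun m n} {hΦ : MemLpMat ∞ Φ} {f : L2 n} :
    f ∈ analyticKer Φ hΦ ↔ f ∈ H2 n ∧ mulOp Φ hΦ f = 0 := Iff.rfl

/-- The kernel of an analytic Toeplitz operator is the kernel of the multiplication operator. -/
theorem map_ker_toeplitz {Φ : MatFun m n} (hΦ : MemHpMat ∞ Φ) :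
    (LinearMap.ker (toeplitz Φ hΦ.1)).map (H2 n).subtype = analyticKer Φ hΦ.1 := by
  have h : ∀ f : H2 n, (toeplitz Φ hΦ.1 f : L2 m) = mulOp Φ hΦ.1 f := fun f =>
    Submodule.starProjection_eq_self_iff.2 (mulOp_mem_H2 hΦ f.2)
  ext f
  rw [mem_analyticKer]
  constructor
  · rintro ⟨f, hf, rfl⟩
    have hf : toeplitz Φ hΦ.1 f = 0 := hf
    exact ⟨f.2, by rw [Submodule.subtype_apply, ← h, hf, Submodule.coe_zero]⟩
  · rintro ⟨hf, h0⟩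
    exact ⟨⟨f, hf⟩, Subtype.ext ((h _).trans h0), rfl⟩

/-- The kernel of multiplication by `Φ` is the orthogonal complement of the range of multiplication
by `Φ*`, hence closed. -/
theorem isClosed_analyticKer (Φ : MatFun m n) (hΦ : MemLpMat ∞ Φ) :
    IsClosed (analyticKer Φ hΦ : Set (L2 n)) := by
  have h : LinearMap.ker (mulOp Φ hΦ) =
      (LinearMap.range (mulOp (fun t => (Φ t)ᴴ) hΦ.conjTranspose))ᗮ := by
    ext f
    rw [LinearMap.mem_ker, Submodule.mem_orthogonal]
    constructor
    · rintro hf _ ⟨g, rfl⟩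
      rw [← inner_mulOp_right hΦ, hf, inner_zero_right]
    · intro hf
      rw [← inner_self_eq_zero (𝕜 := ℂ), inner_mulOp_right]
      exact hf _ ⟨_, rfl⟩
  rw [analyticKer, h]
  exact (isClosed_H2 n).inter (Submodule.isClosed_orthogonal _)

theorem shift_mem_analyticKer {Φ : MatFun m n} {hΦ : MemLpMat ∞ Φ} (f : L2 n)
    (hf : f ∈ analyticKer Φ hΦ) : shift n 1 f ∈ analyticKer Φ hΦ :=
  ⟨shift_mem_H2 zero_le_one hf.1, show mulOp Φ hΦ (shift n 1 f) = 0 by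
    rw [mulOp_shift, show mulOp Φ hΦ f = 0 from hf.2, map_zero]⟩

/-- If `Φ` annihilates `Θ H²`, then `Φ Θ = 0`. -/
theorem mul_eq_zero_of_map_le {Φ : MatFun m n} {hΦ : MemLpMat ∞ Φ} {Θ : MatFun n k}
    {hΘ : MemLpMat ∞ Θ} (h : (H2 k).map (mulOp Θ hΘ) ≤ analyticKer Φ hΦ) :
    ∀ᵐ t ∂σ, Φ t * Θ t = 0 := by
  have h1 : ∀ a : Fin k, ∀ᵐ t ∂σ, Φ t *ᵥ (Θ t *ᵥ Pi.single a 1) = 0 := by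
    intro a
    have h2 := h ⟨_, constL2_mem_H2 (EuclideanSpace.single a (1 : ℂ)), rfl⟩
    filter_upwards [(mulOp_eq_zero_iff hΦ _).1 h2.2, coeFn_mulOp hΘ (constL2 _),
      coeFn_constL2 (EuclideanSpace.single a (1 : ℂ))] with t h3 h4 h5
    rw [h4, mulFun, h5] at h3
    exact h3
  filter_upwards [ae_all_iff.2 h1] with t ht
  ext i a
  have := congrFun (ht a) i
  rw [Matrix.mulVec_mulVec, Matrix.mulVec_single_one] at this
  exact this

theorem conjBlock_isometric {Υ : MatFun n r} {Θ : MatFun n k} {t : UnitAddCircle}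
    (hΥ : (Υ t)ᴴ * Υ t = 1) (hΘ : (Θ t)ᴴ * Θ t = 1) (h : (Υ t)ᵀ * Θ t = 0) :
    (conjBlock Υ Θ t)ᴴ * conjBlock Υ Θ t = 1 := by
  have h1 : (Υ t)ᴴ * (Θ t).map star = 0 := by
    have := congrArg (fun A => A.map (starRingEnd ℂ)) h
    simp only [Matrix.map_mul, Matrix.map_zero, map_zero] at this
    exact this
  have h2 : ((Θ t).map star)ᴴ * (Υ t) = 0 := by
    rw [← Matrix.conjTranspose_conjTranspose (Υ t), ← Matrix.conjTranspose_mul, h1,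
      Matrix.conjTranspose_zero]
  have h3 : ((Θ t).map star)ᴴ * (Θ t).map star = 1 := by
    have := congrArg (fun A => A.map (starRingEnd ℂ)) hΘ
    simp only [Matrix.map_mul, Matrix.map_one, map_zero, map_one] at this
    exact this
  rw [conjBlock, Matrix.conjTranspose_fromCols_eq_fromRows_conjTranspose,
    Matrix.fromRows_mul_fromCols, hΥ, h1, h2, h3, Matrix.fromBlocks_one]

theorem add_le_of_conjBlock_isometric {V : Matrix (Fin n) (Fin r ⊕ Fin k) ℂ} (h : Vᴴ * V = 1) :
    r + k ≤ n := by
  have h1 := Matrix.rank_mul_le_right Vᴴ V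
  rw [h, Matrix.rank_one, Fintype.card_sum, Fintype.card_fin, Fintype.card_fin] at h1
  exact h1.trans ((Matrix.rank_le_card_height V).trans_eq (Fintype.card_fin n))

/-- The minor vectors of `Υ` belong to the analytic kernel. There are finitely many row choices, so
at almost every point all of them lie in the range of `Θ(t)`. -/
theorem le_add_of_analyticKer_le {Υ : MatFun n r} (hΥ : IsInner Υ) {Θ : MatFun n k}
    {hΘ : MemLpMat ∞ Θ}
    (h : analyticKer (transposeFun Υ) hΥ.memHp.1.transpose ≤ (H2 k).map (mulOp Θ hΘ)) :
    n ≤ r + k := by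
  have h1 : ∀ s, ∀ᵐ t ∂σ, minorVec (Υ t) s ∈ LinearMap.range (Θ t).mulVecLin := by
    intro s
    have hv := memLp_minorVec hΥ.memHp s
    have hmem : hv.toLp _ ∈ analyticKer (transposeFun Υ) hΥ.memHp.1.transpose := by
      refine ⟨mem_H2_iff.2 fun i q hq => ?_, (mulOp_eq_zero_iff _ _).2 ?_⟩
      · rw [← (minorVec_mem_HInf hΥ.memHp s i).2 q hq]
        refine congrFun (fourierCoeff_congr_ae ?_) q
        filter_upwards [hv.coeFn_toLp] with t ht
        rw [ht]
      · filter_upwards [hv.coeFn_toLp] with t ht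
        rw [ht]
        exact transpose_mulVec_minorVec _ _
    obtain ⟨u, -, hu⟩ := h hmem
    filter_upwards [hv.coeFn_toLp, coeFn_mulOp hΘ u] with t h2 h3
    rw [hu, h2] at h3
    exact ⟨(u t).ofLp, (congrArg WithLp.ofLp h3).symm⟩
  obtain ⟨t, h2, h3⟩ := ((ae_all_iff.2 h1).and hΥ.isometric).exists
  exact le_add_of_minorVec_mem_range h3 h2

theorem memLp_conj_shift (g : L2 k) :
    MemLp (fun t => WithLp.toLp 2 fun a => conj (shift k 1 g t a)) 2 σ :=
  memLp_piLp_iff.2 fun a => (memLp_coord (shift k 1 g) a).star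

/-- The function `z̄ ḡ`. -/
noncomputable def conjShift (g : L2 k) : L2 k := (memLp_conj_shift g).toLp _

theorem coeFn_conjShift (g : L2 k) :
    conjShift g =ᵐ[σ] fun t => WithLp.toLp 2 fun a => conj (shift k 1 g t a) :=
  (memLp_conj_shift g).coeFn_toLp

theorem fourierCoeff_conjShift (g : L2 k) (j : ℤ) (a : Fin k) :
    fourierCoeff (conjShift g) j a = conj (fourierCoeff g (-1 - j) a) := by
  rw [fourierCoeff_coord, show (-1 - j) = -j - 1 by ring, ← fourierCoeff_shift, fourierCoeff_coord,
    ← fourierCoeff_conj]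
  refine congrFun (fourierCoeff_congr_ae ?_) j
  filter_upwards [coeFn_conjShift g] with t ht
  rw [ht]

/-- The map `g ↦ z̄ḡ` exchanges the indices `j` and `-1 - j`, hence the negative and nonnegative
halves of the spectrum. -/
theorem eq_zero_of_conjShift_mem_H2 {g : L2 k} (hg : g ∈ H2 k) (h : conjShift g ∈ H2 k) :
    g = 0 := by
  refine eq_zero_of_fourierCoeff_eq_zero fun j => ?_
  rcases lt_or_ge j 0 with hj | hj
  · exact hg j hj
  · ext a
    have h1 := fourierCoeff_conjShift g (-1 - j) a
    rw [show fourierCoeff (conjShift g) (-1 - j) = 0 from h _ (by omega), sub_sub_cancel] at h1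
    exact (map_eq_zero _).1 h1.symm

theorem mem_polySpan {F : MatFun m n} (hF : MemLpMat ∞ F) (j : ℕ) (x : EuclideanSpace ℂ (Fin n)) :
    mulOp F hF (shift n j (constL2 x)) ∈ polySpan F := by
  refine Submodule.subset_span ⟨j, x, ?_⟩
  filter_upwards [coeFn_mulOp hF (shift n j (constL2 x)), coeFn_shift j (constL2 x),
    coeFn_constL2 x] with t h1 h2 h3
  rw [h1, mulFun, h2, h3, mulFun]

theorem polySpan_le_H2 {F : MatFun m n} (hF : MemHpMat ∞ F) : polySpan F ≤ H2 m := by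
  rw [polySpan, Submodule.span_le]
  rintro g ⟨j, x, hg⟩
  have h : g = mulOp F hF.1 (shift n j (constL2 x)) := by
    refine Lp.ext ?_
    filter_upwards [hg, coeFn_mulOp hF.1 (shift n j (constL2 x)), coeFn_shift j (constL2 x),
      coeFn_constL2 x] with t h0 h1 h2 h3
    rw [h0, h1, mulFun, mulFun, h2, h3]
  rw [h]
  exact mulOp_mem_H2 hF (shift_mem_H2 (by omega) (constL2_mem_H2 x))

/-- If `g` is orthogonal to `Θᵗ z ^ j x` for all `j ≥ 0`, then `z̄ Θ ḡ` is analytic. -/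
theorem mulOp_conjShift_mem_H2 {Θ : MatFun n k} (hΘ : MemLpMat ∞ Θ) {g : L2 k}
    (hg : g ∈ (polySpan (transposeFun Θ))ᗮ) : mulOp Θ hΘ (conjShift g) ∈ H2 n := by
  rw [mem_H2_iff]
  intro i q hq
  -- The coefficient of `Θ z̄ḡ` at `-1 - j` is the integral of `zʲ Θ ḡ`, the factor `z̄` absorbing
  -- the `-1`; its entry `i` is the inner product of `g` with `Θᵗ zʲ eᵢ`.
  obtain ⟨j, rfl⟩ : ∃ j : ℕ, q = -1 - (j : ℤ) := ⟨(-1 - q).toNat, by omega⟩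
  have h1 := Submodule.inner_left_of_mem_orthogonal
    (mem_polySpan hΘ.transpose j (EuclideanSpace.single i (1 : ℂ))) hg
  rw [← h1, L2.inner_def, fourierCoeff]
  refine integral_congr_ae ?_
  filter_upwards [coeFn_mulOp hΘ (conjShift g), coeFn_conjShift g, coeFn_shift 1 g,
    coeFn_mulOp hΘ.transpose (shift n j (constL2 (EuclideanSpace.single i (1 : ℂ)))),
    coeFn_shift j (constL2 (EuclideanSpace.single i (1 : ℂ))),
    coeFn_constL2 (EuclideanSpace.single i (1 : ℂ))] with t h2 h3 h4 h5 h6 h7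
  rw [h2, h5, mulFun_apply, PiLp.inner_apply, smul_eq_mul, Finset.mul_sum]
  refine Finset.sum_congr rfl fun a _ => ?_
  rw [mulFun_apply, h6, h7, Finset.sum_eq_single i, h3, h4]
  · simp only [RCLike.inner_apply', PiLp.smul_apply, smul_eq_mul, map_mul, transposeFun,
      Matrix.transpose_apply, PiLp.single_apply, if_true, mul_one]
    rw [← fourier_neg, show (-(-1 - (j : ℤ))) = j + 1 by ring, fourier_add]
    have h8 : (fourier 1 t : ℂ) * fourier (-1) t = 1 := by
      rw [← fourier_add, add_neg_cancel, fourier_zero]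
    linear_combination (fourier (j : ℤ) t * Θ t i a * conj (g t a)) * h8
  · intro b _ hb
    simp [hb]
  · simp

theorem isCoOuter_of_analyticKer_eq {Φ : MatFun m n} {hΦ : MemLpMat ∞ Φ} {Θ : MatFun n k}
    (hΘ : IsInner Θ) (h : analyticKer Φ hΦ = (H2 k).map (mulOp Θ hΘ.memHp.1)) :
    IsCoOuter Θ := by
  refine ⟨hΘ.memHp.transpose.two, ?_⟩
  have hle : (polySpan (transposeFun Θ)).topologicalClosure ≤ H2 k :=
    Submodule.topologicalClosure_minimal _ (polySpan_le_H2 hΘ.memHp.transpose) (isClosed_H2 k)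
  have := (Submodule.isClosed_topologicalClosure (polySpan (transposeFun Θ))).completeSpace_coe
  have hsup := Submodule.sup_orthogonal_inf_of_hasOrthogonalProjection hle
  have hbot : (polySpan (transposeFun Θ)).topologicalClosureᗮ ⊓ H2 k = ⊥ := by
    rw [eq_bot_iff]
    rintro g ⟨hg1, hg2⟩
    rw [Submodule.orthogonal_closure] at hg1
    have hmem : mulOp Θ hΘ.memHp.1 (conjShift g) ∈ analyticKer Φ hΦ := by
      refine ⟨mulOp_conjShift_mem_H2 hΘ.memHp.1 hg1, (mulOp_eq_zero_iff hΦ _).2 ?_⟩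
      filter_upwards [mul_eq_zero_of_map_le h.ge, coeFn_mulOp hΘ.memHp.1 (conjShift g)]
        with t h1 h2
      rw [h2, mulFun, Matrix.mulVec_mulVec, h1, Matrix.zero_mulVec]
    rw [h] at hmem
    obtain ⟨u, hu, he⟩ := hmem
    have hinj := (mulIsom Θ hΘ.memHp.1 hΘ.isometric).injective he
    exact (Submodule.mem_bot ℂ).2 (eq_zero_of_conjShift_mem_H2 hg2 (hinj ▸ hu))
  rwa [hbot, sup_bot_eq] at hsup

end MatrixHardy

theorem theorem3p1 (n r : ℕ) (hr : 0 < r) (hrn : r < n)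
    (Υ : MatrixHardy.MatFun n r) (hΥ : MatrixHardy.IsInner Υ) (hΥ' : MatrixHardy.IsCoOuter Υ) :
    ∃ (Θ : MatrixHardy.MatFun n (n - r)) (hΘ : MatrixHardy.IsInner Θ),
      MatrixHardy.IsCoOuter Θ ∧
      (LinearMap.ker (MatrixHardy.toeplitz (MatrixHardy.transposeFun Υ)
          hΥ.memHp.1.transpose)).map (MatrixHardy.H2 n).subtype =
        (MatrixHardy.H2 (n - r)).map (MatrixHardy.mulOp Θ hΘ.memHp.1) ∧
      MatrixHardy.IsBalanced (MatrixHardy.conjBlock Υ Θ) := by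
  open MatrixHardy in
  obtain ⟨k, Θ, hΘ, hker⟩ := exists_inner_of_shift_invariant
    (isClosed_analyticKer (transposeFun Υ) hΥ.memHp.1.transpose) inf_le_left
    shift_mem_analyticKer
  have hiso : ∀ᵐ t ∂σ, (conjBlock Υ Θ t)ᴴ * conjBlock Υ Θ t = 1 := by
    filter_upwards [hΥ.isometric, hΘ.isometric, mul_eq_zero_of_map_le hker.ge] with t h1 h2 h3
    exact conjBlock_isometric h1 h2 h3
  -- Isometry of `(Υ Θ̄)` bounds `k` above; the minor vectors bound it below.
  have hk : k = n - r := by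
    obtain ⟨t, ht⟩ := hiso.exists
    have h1 := add_le_of_conjBlock_isometric ht
    have h2 := le_add_of_analyticKer_le hΥ hker.le
    omega
  subst hk
  have hco := isCoOuter_of_analyticKer_eq hΘ hker
  refine ⟨Θ, hΘ, hco, (map_ker_toeplitz hΥ.memHp.transpose).trans hker, hr, hrn, ?_,
    Υ, Θ, hΥ, hΥ', hΘ, hco, Filter.EventuallyEq.rfl⟩
  filter_upwards [hiso] with t ht
  -- The block matrix is square, so a left inverse is also a right inverse.
  refine ⟨ht, (Matrix.mul_eq_one_comm_of_card_eq _ _ _ ?_).1 ht⟩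
  simp only [Fintype.card_sum, Fintype.card_fin]
  omega
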